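/- Let $\mathbb K$ be an algebraically closed field of characteristic $0$, let $q\in\mathbb K$ be nonzero and not a root of unity, and let $V$ be a $\mathbb K$-vector space of finite positive dimension. A tridiagonal pair on $V$ is an ordered pair $A,A^*$ of linear maps $V\to V$ such that: (i) each of $A,A^*$ is diagonalizable; (ii) the eigenspaces of $A$ can be ordered $V_0,\dots,V_d$ so that $A^*V_i\subseteq V_{i-1}+V_i+V_{i+1}$ for $0\le i\le d$, where $V_{-1}=V_{d+1}=0$; (iii) the eigenspaces of $A^*$ can be ordered $V^*_0,\dots,V^*_\delta$ so that $AV^*_i\subseteq V^*_{i-1}+V^*_i+V^*_{i+1}$ for $0\le i\le\delta$, where $V^*_{-1}=V^*_{\delta+1}=0$; (iv) there is no subspace $W$ of $V$ with $AW\subseteq W$, $A^*W\subseteq W$, $W\ne0$, $W\ne V$. It is known that $d=\delta$. An ordering of the eigenspaces as in (ii) or (iii), and the corresponding ordering of the eigenvalues, is called standard. Let $A,A^*$ be a tridiagonal pair on $V$ such that, with $\beta=q^2+q^{-2}$ and $[r,s]=rs-sr$, $$[A,\,A^2A^*-\beta AA^*A+A^*A^2]=0,\qquad [A^*,\,A^{*2}A-\beta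 A^*AA^*+AA^{*2}]=0.$$ Let $\theta_0,\dots,\theta_d$ and $\theta^*_0,\dots,\theta^*_d$ be standard orderings of the eigenvalues of $A$ and $A^*$ of the form $\theta_i=aq^{2i-d}$ and $\theta^*_i=a^*q^{d-2i}$ $(0\le i\le d)$ with $a,a^*\in\mathbb K$. Let $U_0,\dots,U_d$ be the corresponding split decomposition, that is, the sequence of subspaces with $V=U_0\oplus\cdots\oplus U_d$ and $$(A-\theta_iI)U_i\subseteq U_{i+1}\ (0\le i<d),\quad (A-\theta_dI)U_d=0,\qquad (A^*-\theta^*_iI)U_i\subseteq U_{i-1}\ (0<i\le d),\quad (A^*-\theta^*_0I)U_0=0.$$ Let $F_i$ be the projection of $V$ onto $U_i$ along $\sum_{j\ne i}U_j$, and let $R=A-\sum_{h=0}^d\theta_hF_h$ and $L=A^*-\sum_{h=0}^d\theta^*_hF_h$ be the raising and lowering maps. Then $U_0\neq0$, and for every nonzero $v\in U_0$ the space $V$ is spanned by the vectors $$L^{i_1}R^{i_2}L^{i_3}R^{i_4}\cdots R^{i_n}v,$$ where $n$ ranges over the nonnegative even integers and $i_1,\dots,i_n$ over the integers with $0\le i_1<i_2<\cdots<i_n\le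 d$. -/

import Mathlib

namespace TDPair

variable {K V : Type*} [Field K] [AddCommGroup V] [Module K V]

/-- `A` is diagonalizable: `V` is spanned by the eigenspaces of `A`. -/
def IsDiagonalizable (A : Module.End K V) : Prop :=
  ⨆ μ : K, A.eigenspace μ = ⊤

/-- `θ 0, …, θ d` is a standard ordering of the eigenvalues of `A` (with respect to `B`): it lists
every eigenvalue of `A` exactly once, and the eigenspaces `V i` of `A` for `θ i` satisfy
`B (V i) ⊆ V (i - 1) + V i + V (i + 1)`, where the terms with index outside `{0, …, d}` are
absent. -/
structure IsStandardOrdering (A B : Module.End K V) {d : ℕ} (θ : Fin (d + 1) → K) : Prop where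
  injective : Function.Injective θ
  range_eq : Set.range θ = {μ : K | A.HasEigenvalue μ}
  tridiagonal : ∀ i : Fin (d + 1), (A.eigenspace (θ i)).map B ≤
    ⨆ (j : Fin (d + 1)) (_ : (i : ℕ) ≤ j + 1 ∧ (j : ℕ) ≤ i + 1), A.eigenspace (θ j)

/-- Tridiagonal pairs. -/
structure IsTridiagonalPair (A Astar : Module.End K V) : Prop where
  diagonalizable : IsDiagonalizable A
  diagonalizable_star : IsDiagonalizable Astar
  ordering : ∃ (d : ℕ) (θ : Fin (d + 1) → K), IsStandardOrdering A Astar θ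
  ordering_star : ∃ (δ : ℕ) (θstar : Fin (δ + 1) → K), IsStandardOrdering Astar A θstar
  irreducible : ¬ ∃ W : Submodule K V, W.map A ≤ W ∧ W.map Astar ≤ W ∧ W ≠ ⊥ ∧ W ≠ ⊤

/-- The tridiagonal relations with parameters `β, γ, γ*, ϱ, ϱ*`. The bracket is the commutator
`⁅r, s⁆ = r * s - s * r`, and the product of endomorphisms is composition. -/
structure TridiagonalRelations (A Astar : Module.End K V) (β γ γstar ϱ ϱstar : K) : Prop where
  rel : ⁅A, A ^ 2 * Astar - β • (A * Astar * A) + Astar * A ^ 2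
      - γ • (A * Astar + Astar * A) - ϱ • Astar⁆ = 0
  rel_star : ⁅Astar, Astar ^ 2 * A - β • (Astar * A * Astar) + A * Astar ^ 2
      - γstar • (Astar * A + A * Astar) - ϱstar • A⁆ = 0

/-- `U 0, …, U d` is the split decomposition of `V` for `A, A*` with respect to the orderings
`θ` and `θ*` of the eigenvalues. -/
structure IsSplitDecomposition (A Astar : Module.End K V) {d : ℕ} (θ θstar : Fin (d + 1) → K)
    (U : Fin (d + 1) → Submodule K V) : Prop where
  isInternal : DirectSum.IsInternal U
  raise : ∀ i : Fin d, ∀ u ∈ U i.castSucc, A u - θ i.castSucc • u ∈ U i.succ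
  raise_last : ∀ u ∈ U (Fin.last d), A u - θ (Fin.last d) • u = 0
  lower : ∀ i : Fin d, ∀ u ∈ U i.succ, Astar u - θstar i.succ • u ∈ U i.castSucc
  lower_zero : ∀ u ∈ U 0, Astar u - θstar 0 • u = 0

/-- The projection `F i` of `V` onto `U i` along the sum of the `U j`, `j ≠ i`. -/
noncomputable def proj {d : ℕ} {U : Fin (d + 1) → Submodule K V}
    (hU : DirectSum.IsInternal U) (i : Fin (d + 1)) : Module.End K V :=
  (U i).subtype ∘ₗ DirectSum.component K (Fin (d + 1)) (fun j => U j) i ∘ₗ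
    (LinearEquiv.ofBijective (DirectSum.coeLinearMap U) hU).symm.toLinearMap

theorem proj_of_mem {d : ℕ} {U : Fin (d + 1) → Submodule K V}
    (hU : DirectSum.IsInternal U) (i : Fin (d + 1)) {u : V} (hu : u ∈ U i) :
    proj hU i u = u := by
  exact congrArg Subtype.val (hU.ofBijective_coeLinearMap_of_mem hu)

theorem proj_of_mem_ne {d : ℕ} {U : Fin (d + 1) → Submodule K V}
    (hU : DirectSum.IsInternal U) {i j : Fin (d + 1)} (hij : j ≠ i) {u : V} (hu : u ∈ U j) :
    proj hU i u = 0 := by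
  exact congrArg Subtype.val (hU.ofBijective_coeLinearMap_of_mem_ne hij hu)

/-- The raising map `R = A - ∑ θ h F h` of the split decomposition `U`. -/
noncomputable def raisingMap {A Astar : Module.End K V} {d : ℕ} {θ θstar : Fin (d + 1) → K}
    {U : Fin (d + 1) → Submodule K V} (hU : IsSplitDecomposition A Astar θ θstar U) :
    Module.End K V :=
  A - ∑ h, θ h • proj hU.isInternal h

/-- The lowering map `L = A* - ∑ θ* h F h` of the split decomposition `U`. -/
noncomputable def loweringMap {A Astar : Module.End K V} {d : ℕ} {θ θstar : Fin (d + 1) → K}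
    {U : Fin (d + 1) → Submodule K V} (hU : IsSplitDecomposition A Astar θ θstar U) :
    Module.End K V :=
  Astar - ∑ h, θstar h • proj hU.isInternal h

/-- `altWord X Y [i₁, i₂, i₃, …] = X ^ i₁ * Y ^ i₂ * X ^ i₃ * ⋯`, with alternating letters. -/
def altWord (X Y : Module.End K V) : List ℕ → Module.End K V
  | [] => 1
  | i :: l => X ^ i * altWord Y X l

/-- The vectors `L ^ i₁ R ^ i₂ L ^ i₃ ⋯ R ^ iₙ v` with `n` even and
`0 ≤ i₁ < i₂ < ⋯ < iₙ ≤ d`; the case `n = 0` gives `v` itself. -/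
def wordVectors (L R : Module.End K V) (d : ℕ) (v : V) : Set V :=
  {w | ∃ l : List ℕ, Even l.length ∧ l.Pairwise (· < ·) ∧ (∀ i ∈ l, i ≤ d) ∧
    w = altWord L R l v}

end TDPair

/-! Comparing components of a suitable degree in the relations for `A` and `A*` shows that `R` and
`L` satisfy both `q`-Serre relations with `Q = q²` (`serre_eq_zero_of_graded`). Iterating
`q`-commutators, one finds that for `(x, y)` equal to `(R, L)` or `(L, R)` and any linear functional
`φ`, the sequence `r ↦ φ (x ^ r y ^ j x ^ (m - r))` is a combination of `2j + 1` geometric sequences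
with ratios `Q ^ (-j), …, Q ^ j`. As `Q` is not a root of unity, such a sequence vanishes once it
has `2j + 1` zeros.

This interpolation principle is used twice. It rewrites a word having an exponent `j` in a valley
between larger exponents (`mem_span_of_serre`); the rewriting terminates, leaving strictly
increasing words and words that end in `L ^ b R ^ c` with `c ≤ b`. It also shows that the maps `L ^
i R ^ i` commute on `U 0` (`lower_raise_comm`), so they have a common eigenvector `v` there.

On this `v` a final `L ^ b R ^ c` is zero if `c < b` and a scalar if `c = b`. Hence the increasing
words applied to `v` span a subspace stable under `R` and `L`, so under `A` and `A*`, and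
irreducibility makes it all of `V`. Nonempty increasing words have positive degree, so `U 0` is the
line through `v`, and the result holds for each of its nonzero vectors. -/

namespace TDPair

/-! ### Iterated `q`-commutators and interpolation for the `q`-Serre relation -/

section QCommutator

variable {K S : Type*} [Field K] [Ring S] [Algebra K S]

/-- `f` is annihilated by the successive `q`-commutators `f ↦ x f - (s Q ^ k) f x`, `k < n`. -/
def IsKilled (Q : K) (x : S) : ℕ → K → S → Prop
  | 0, _, f => f = 0
  | n + 1, s, f => IsKilled Q x n (s * Q) (x * f - s • (f * x))

theorem IsKilled.zero (Q : K) (x : S) (n : ℕ) (s : K) : IsKilled Q x n s 0 := by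
  induction n generalizing s with
  | zero => rfl
  | succ n ih => simpa [IsKilled] using ih (s * Q)

theorem IsKilled.add {Q : K} {x : S} {n : ℕ} {s : K} {f g : S}
    (hf : IsKilled Q x n s f) (hg : IsKilled Q x n s g) : IsKilled Q x n s (f + g) := by
  induction n generalizing s f g with
  | zero =>
    simp only [IsKilled] at *
    rw [hf, hg, add_zero]
  | succ n ih =>
    have h := ih (s := s * Q) hf hg
    simp only [IsKilled]
    convert h using 1
    rw [mul_add, add_mul, smul_add]
    abel

theorem IsKilled.smul {Q : K} {x : S} {n : ℕ} {s : K} {f : S} (a : K)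
    (hf : IsKilled Q x n s f) : IsKilled Q x n s (a • f) := by
  induction n generalizing s f with
  | zero =>
    simp only [IsKilled] at *
    rw [hf, smul_zero]
  | succ n ih =>
    have h := ih (s := s * Q) hf
    simp only [IsKilled]
    convert h using 1
    rw [mul_smul_comm, smul_mul_assoc, smul_sub, smul_comm a s]

/-- Twisted Leibniz rule: the `q`-commutator of `f * g` with parameter `s * t` is a sum of two
products, each with one factor already commutated once. Both continue with the parameter `s * t *
Q`, so the induction closes. -/
theorem IsKilled.mul {Q : K} {x : S} (N : ℕ) : ∀ {n m : ℕ}, n + m = N → ∀ {s t : K} {f g : S},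
    IsKilled Q x (n + 1) s f → IsKilled Q x (m + 1) t g →
      IsKilled Q x (N + 1) (s * t) (f * g) := by
  induction N with
  | zero =>
    intro n m h s t f g hf hg
    obtain ⟨rfl, rfl⟩ : n = 0 ∧ m = 0 := by omega
    simp only [IsKilled, sub_eq_zero] at *
    rw [← mul_assoc, hf, smul_mul_assoc, mul_assoc, hg, mul_smul_comm, smul_smul, mul_assoc]
  | succ N ih =>
    intro n m h s t f g hf hg
    have key : x * (f * g) - (s * t) • (f * g * x)
        = (x * f - s • (f * x)) * g + s • (f * (x * g - t • (g * x))) := by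
      simp only [sub_mul, mul_sub, smul_sub, smul_mul_assoc, mul_smul_comm, smul_smul, mul_assoc]
      abel
    change IsKilled Q x (N + 1) (s * t * Q) (x * (f * g) - (s * t) • (f * g * x))
    rw [key]
    refine IsKilled.add ?_ (IsKilled.smul s ?_)
    · rcases n with _ | n
      · have hf' : x * f - s • (f * x) = 0 := hf
        rw [hf', zero_mul]
        exact IsKilled.zero ..
      · rw [mul_right_comm]
        exact ih (by omega) hf hg
    · rcases m with _ | m
      · have hg' : x * g - t • (g * x) = 0 := hg
        rw [hg', mul_zero]
        exact IsKilled.zero ..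
      · rw [mul_assoc]
        exact ih (by omega) hf hg

theorem IsKilled.pow {Q : K} {x y : S} {n : ℕ} {s : K} (hy : IsKilled Q x (n + 1) s y) (j : ℕ) :
    IsKilled Q x (n * j + 1) (s ^ j) (y ^ j) := by
  induction j with
  | zero => simp [IsKilled]
  | succ j ih =>
    rw [pow_succ, pow_succ]
    exact IsKilled.mul _ (by ring) ih hy

/-- The `q`-Serre expression `[x, x² y - (Q + Q⁻¹) x y x + y x²]`. -/
def serre (Q : K) (x y : S) : S :=
  x ^ 3 * y - (Q + 1 + Q⁻¹) • (x ^ 2 * y * x) + (Q + 1 + Q⁻¹) • (x * y * x ^ 2) - y * x ^ 3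

theorem isKilled_of_serre {Q : K} (hQ : Q ≠ 0) {x y : S} (h : serre Q x y = 0) :
    IsKilled Q x 3 Q⁻¹ y := by
  simp only [IsKilled, inv_mul_cancel₀ hQ, one_mul, one_smul]
  rw [← h, serre]
  simp only [mul_sub, sub_mul, smul_sub, smul_mul_assoc, mul_smul_comm, smul_smul, mul_assoc,
    pow_succ, pow_zero, one_mul, mul_inv_cancel₀ hQ, one_smul, add_smul]
  abel

/-- Sliding `x` across `f` is a linear recurrence in `r` with the distinct characteristic roots `s *
Q ^ k`, `k < n`. -/
theorem IsKilled.exists_coeff {Q : K} (hQ : ∀ n : ℕ, 0 < n → Q ^ n ≠ 1) {x : S}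
    (φ : S →ₗ[K] K) (n : ℕ) : ∀ {s : K}, s ≠ 0 → Q ≠ 0 → ∀ {f : S}, IsKilled Q x n s f →
      ∀ m : ℕ, ∃ c : ℕ → K, ∀ r ≤ m,
        φ (x ^ r * f * x ^ (m - r)) = ∑ k ∈ Finset.range n, c k * (s * Q ^ k) ^ r := by
  induction n with
  | zero =>
    intro s _ _ f hf m
    refine ⟨0, fun r _ => ?_⟩
    have hf : f = 0 := hf
    simp [hf]
  | succ n ih =>
    intro s hs hQ0 f hf m
    -- The `q`-commutator absorbs one factor `x`, which leaves total exponent `m - 1`.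
    obtain ⟨c, hc⟩ := ih (mul_ne_zero hs hQ0) hQ0 hf (m - 1)
    -- A particular solution of the first-order recurrence of ratio `s`; the remaining coefficient,
    -- of the ratio `s` itself, is fixed by the value at `r = 0`.
    let b : ℕ → K := fun k => c k / (s * Q ^ (k + 1) - s)
    refine ⟨fun k => Nat.casesOn k (φ (f * x ^ m) - ∑ k ∈ Finset.range n, b k) b, fun r => ?_⟩
    rw [Finset.sum_range_succ']
    induction r with
    | zero => intro _; simp
    | succ r ihr =>
      intro hr
      have h1 := ihr (by omega)
      have h2 := hc r (by omega)
      have h3 : x ^ (r + 1) * f * x ^ (m - (r + 1))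
          = s • (x ^ r * f * x ^ (m - r))
            + x ^ r * (x * f - s • (f * x)) * x ^ (m - 1 - r) := by
        have e1 : m - r = (m - (r + 1)) + 1 := by omega
        have e2 : m - 1 - r = m - (r + 1) := by omega
        rw [e1, e2, pow_succ' x (m - (r + 1)), pow_succ x r]
        simp only [mul_sub, sub_mul, smul_mul_assoc, mul_smul_comm, mul_assoc]
        abel
      rw [h3, map_add, map_smul, h1, h2, smul_eq_mul, mul_add, Finset.mul_sum]
      have h4 : ∀ k, b k * (s * Q ^ (k + 1)) ^ (r + 1)
          = s * (b k * (s * Q ^ (k + 1)) ^ r) + c k * (s * Q * Q ^ k) ^ r := by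
        intro k
        have hne : s * Q ^ (k + 1) - s ≠ 0 := by
          intro h0
          have : s * (Q ^ (k + 1) - 1) = 0 := by linear_combination h0
          rcases mul_eq_zero.1 this with h | h
          · exact hs h
          · exact hQ (k + 1) (by omega) (sub_eq_zero.1 h)
        have hb : c k = b k * (s * Q ^ (k + 1) - s) :=
          (div_mul_cancel₀ _ hne).symm
        rw [hb]
        ring
      simp only [h4, Finset.sum_add_distrib]
      simp only [pow_zero, mul_one]
      ring

/-- The sum at `t` is `s ^ t` times the value at `Q ^ t` of a polynomial of degree less than `n`,
and the points `Q ^ t` are distinct. -/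
theorem sum_geometric_eq_zero {Q : K} (hQ : ∀ n : ℕ, 0 < n → Q ^ n ≠ 1) (hQ0 : Q ≠ 0) {s : K}
    (hs : s ≠ 0) {n : ℕ} {c : ℕ → K} {T : Finset ℕ} (hT : n ≤ T.card)
    (h : ∀ t ∈ T, ∑ k ∈ Finset.range n, c k * (s * Q ^ k) ^ t = 0) (r : ℕ) :
    ∑ k ∈ Finset.range n, c k * (s * Q ^ k) ^ r = 0 := by
  classical
  have hinj : Function.Injective fun t : ℕ => Q ^ t := by
    intro a b hab
    simp only at hab
    wlog hlt : a < b generalizing a b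
    · rcases Nat.lt_or_ge b a with h' | h'
      · exact (this hab.symm h').symm
      · omega
    exfalso
    apply hQ (b - a) (by omega)
    have : Q ^ a * Q ^ (b - a) = Q ^ a * 1 := by
      rw [← pow_add, mul_one, hab]
      congr 1
      omega
    exact mul_left_cancel₀ (pow_ne_zero _ hQ0) this
  have hrw : ∀ t : ℕ, ∑ k ∈ Finset.range n, c k * (s * Q ^ k) ^ t
      = s ^ t * (∑ k ∈ Finset.range n, Polynomial.monomial k (c k)).eval (Q ^ t) := by
    intro t
    rw [Polynomial.eval_finsetSum, Finset.mul_sum]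
    refine Finset.sum_congr rfl fun k _ => ?_
    rw [Polynomial.eval_monomial, mul_pow, ← pow_mul, ← pow_mul, mul_comm k t]
    ring
  have hp : (∑ k ∈ Finset.range n, Polynomial.monomial k (c k)) = 0 := by
    refine Polynomial.eq_zero_of_degree_lt_of_eval_finset_eq_zero (T.image fun t => Q ^ t) ?_ ?_
    · rw [Finset.card_image_of_injective _ hinj]
      refine lt_of_lt_of_le ?_ (WithBot.coe_le_coe.2 (Nat.cast_le.2 hT))
      refine (Polynomial.degree_sum_le _ _).trans_lt ?_
      rw [Finset.sup_lt_iff (WithBot.bot_lt_coe _)]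
      intro k hk
      exact (Polynomial.degree_monomial_le _ _).trans_lt
        (WithBot.coe_lt_coe.2 (Nat.cast_lt.2 (Finset.mem_range.1 hk)))
    · intro z hz
      obtain ⟨t, ht, rfl⟩ := Finset.mem_image.1 hz
      have := h t ht
      rw [hrw] at this
      exact (mul_eq_zero.1 this).resolve_left (pow_ne_zero _ hs)
  rw [hrw, hp]
  simp

theorem exists_coeff_of_serre {Q : K} (hQ : ∀ n : ℕ, 0 < n → Q ^ n ≠ 1) (hQ0 : Q ≠ 0) {x y : S}
    (h : serre Q x y = 0) (φ : S →ₗ[K] K) (j m : ℕ) :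
    ∃ c : ℕ → K, ∀ r ≤ m, φ (x ^ r * y ^ j * x ^ (m - r))
      = ∑ k ∈ Finset.range (2 * j + 1), c k * (Q⁻¹ ^ j * Q ^ k) ^ r :=
  ((isKilled_of_serre hQ0 h).pow j).exists_coeff hQ φ _ (pow_ne_zero _ (inv_ne_zero hQ0)) hQ0 m

/-- The set of ratios `Q ^ (-j), …, Q ^ j` is closed under inversion, so the substitution `r ↦ m -
r` keeps the shape of the sum. -/
theorem exists_coeff_of_serre_reflect {Q : K} (hQ : ∀ n : ℕ, 0 < n → Q ^ n ≠ 1) (hQ0 : Q ≠ 0)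
    {x y : S} (h : serre Q x y = 0) (φ : S →ₗ[K] K) (j m : ℕ) :
    ∃ c : ℕ → K, ∀ r ≤ m, φ (x ^ (m - r) * y ^ j * x ^ r)
      = ∑ k ∈ Finset.range (2 * j + 1), c k * (Q⁻¹ ^ j * Q ^ k) ^ r := by
  obtain ⟨c, hc⟩ := exists_coeff_of_serre hQ hQ0 h φ j m
  refine ⟨fun k => c (2 * j - k) * (Q⁻¹ ^ j * Q ^ (2 * j - k)) ^ m, fun r hr => ?_⟩
  have := hc (m - r) (by omega)
  rw [Nat.sub_sub_self hr] at this
  rw [this, ← Finset.sum_range_reflect]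
  refine Finset.sum_congr rfl fun k hk => ?_
  have hk : k ≤ 2 * j := by
    have := Finset.mem_range.1 hk
    omega
  have e : 2 * j + 1 - 1 - k = 2 * j - k := by omega
  rw [e, mul_assoc]
  congr 1
  have e2 : (Q⁻¹ ^ j * Q ^ (2 * j - k)) * (Q⁻¹ ^ j * Q ^ k) = 1 := by
    calc _ = (Q⁻¹) ^ (2 * j) * Q ^ (2 * j - k + k) := by ring
      _ = 1 := by rw [Nat.sub_add_cancel hk, ← mul_pow, inv_mul_cancel₀ hQ0, one_pow]
  calc (Q⁻¹ ^ j * Q ^ (2 * j - k)) ^ (m - r)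
      = (Q⁻¹ ^ j * Q ^ (2 * j - k)) ^ (m - r)
        * ((Q⁻¹ ^ j * Q ^ (2 * j - k)) * (Q⁻¹ ^ j * Q ^ k)) ^ r := by rw [e2, one_pow, mul_one]
    _ = (Q⁻¹ ^ j * Q ^ (2 * j - k)) ^ (m - r + r) * (Q⁻¹ ^ j * Q ^ k) ^ r := by ring
    _ = _ := by rw [Nat.sub_add_cancel hr]

/-- If `x, y` satisfy the `q`-Serre relation, then `x ^ i y ^ j x ^ k` with `i ≥ j < k` is a
combination of the `x ^ r y ^ j x ^ s` with `r + s = i + k` and `r < j` or `s ≤ j`. -/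
theorem mem_span_of_serre {Q : K} (hQ : ∀ n : ℕ, 0 < n → Q ^ n ≠ 1) (hQ0 : Q ≠ 0) {x y : S}
    (h : serre Q x y = 0) {i j k : ℕ} (hij : j ≤ i) (hjk : j < k) :
    x ^ i * y ^ j * x ^ k ∈ Submodule.span K
      {z | ∃ r s : ℕ, r + s = i + k ∧ (r < j ∨ s ≤ j) ∧ z = x ^ r * y ^ j * x ^ s} := by
  -- By duality, a functional that vanishes on the spanning words gives a sequence with `j + (j +
  -- 1)` zeros: those with `r < j` and those with `s ≤ j`. The two ranges are disjoint because `i +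
  -- k > 2 * j`.
  rw [← Subspace.forall_mem_dualAnnihilator_apply_eq_zero_iff]
  intro φ hφ
  rw [Submodule.mem_dualAnnihilator] at hφ
  obtain ⟨c, hc⟩ := exists_coeff_of_serre hQ hQ0 h φ j (i + k)
  have hi := hc i (by omega)
  rw [Nat.add_sub_cancel_left] at hi
  rw [hi]
  refine sum_geometric_eq_zero hQ hQ0 (pow_ne_zero _ (inv_ne_zero hQ0))
    (T := Finset.range j ∪ Finset.Icc (i + k - j) (i + k)) ?_ ?_ i
  · rw [Finset.card_union_of_disjoint, Finset.card_range, Nat.card_Icc]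
    · omega
    · rw [Finset.disjoint_left]
      intro t ht ht'
      rw [Finset.mem_range] at ht
      rw [Finset.mem_Icc] at ht'
      omega
  · intro t ht
    rw [Finset.mem_union, Finset.mem_range, Finset.mem_Icc] at ht
    rw [← hc t (by omega)]
    exact hφ _ (Submodule.subset_span ⟨t, i + k - t, by omega, by omega, rfl⟩)

end QCommutator

/-! ### Commuting maps in degree `0` and their common eigenvector -/

variable {K V : Type*} [Field K] [AddCommGroup V] [Module K V]

/-- `R` raises and `L` lowers the degree of the pieces `G 0, …, G d`, and both pairs `R, L` and
`L, R` satisfy the `q`-Serre relation with `Q = q²`. -/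
structure IsSerreGraded (Q : K) (L R : Module.End K V) (d : ℕ) (G : ℤ → Submodule K V) :
    Prop where
  raise : ∀ n, ∀ u ∈ G n, R u ∈ G (n + 1)
  lower : ∀ n, ∀ u ∈ G n, L u ∈ G (n - 1)
  eq_bot_of_neg : ∀ n < 0, G n = ⊥
  eq_bot_of_lt : ∀ n : ℤ, d < n → G n = ⊥
  serre_raise : serre Q R L = 0
  serre_lower : serre Q L R = 0

namespace IsSerreGraded

variable {Q : K} {L R : Module.End K V} {d : ℕ} {G : ℤ → Submodule K V}

theorem raise_pow (h : IsSerreGraded Q L R d G) (c : ℕ) {n : ℤ} {u : V} (hu : u ∈ G n) :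
    (R ^ c) u ∈ G (n + c) := by
  induction c with
  | zero => simpa using hu
  | succ c ih =>
    rw [pow_succ', Module.End.mul_apply]
    simpa [add_assoc] using h.raise _ _ ih

theorem lower_pow (h : IsSerreGraded Q L R d G) (c : ℕ) {n : ℤ} {u : V} (hu : u ∈ G n) :
    (L ^ c) u ∈ G (n - c) := by
  induction c with
  | zero => simpa using hu
  | succ c ih =>
    rw [pow_succ', Module.End.mul_apply]
    have e : n - ((c + 1 : ℕ) : ℤ) = n - c - 1 := by push_cast; ring
    rw [e]
    exact h.lower _ _ ih

theorem eq_zero_of_neg (h : IsSerreGraded Q L R d G) {n : ℤ} (hn : n < 0) {u : V}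
    (hu : u ∈ G n) : u = 0 := by
  rwa [h.eq_bot_of_neg n hn, Submodule.mem_bot] at hu

theorem eq_zero_of_lt (h : IsSerreGraded Q L R d G) {n : ℤ} (hn : d < n) {u : V}
    (hu : u ∈ G n) : u = 0 := by
  rwa [h.eq_bot_of_lt n hn, Submodule.mem_bot] at hu

/-- The maps `L ^ i R ^ i` and `L ^ j R ^ j` commute on `G 0`. -/
theorem lower_raise_comm (h : IsSerreGraded Q L R d G) (hQ : ∀ n : ℕ, 0 < n → Q ^ n ≠ 1)
    (hQ0 : Q ≠ 0) {u : V} (hu : u ∈ G 0) {i j : ℕ} (hij : i < j) :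
    (L ^ i * R ^ i * L ^ j * R ^ j) u = (L ^ j * R ^ j * L ^ i * R ^ i) u := by
  rw [← sub_eq_zero, ← Module.forall_dual_apply_eq_zero_iff K]
  intro φ
  set N := i + j with hN
  -- The desired commutator is the entry `w i i`. Embedding it in a two-index array lets each column
  -- with `2 * k ≤ N` be treated by interpolation in `r`, by induction on `k`.
  let w : ℕ → ℕ → K := fun r k =>
    φ ((L ^ r * R ^ k * L ^ (N - r) * R ^ (N - k)) u)
      - φ ((L ^ (N - k) * R ^ (N - r) * L ^ k * R ^ r) u)
  have hw0 : ∀ r k, r < k → k ≤ N → w r k = 0 := by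
    intro r k hrk hk
    have e1 : (L ^ (N - r)) ((R ^ (N - k)) u) = 0 :=
      h.eq_zero_of_neg (n := 0 + (N - k : ℕ) - (N - r : ℕ)) (by omega)
        (h.lower_pow _ (h.raise_pow _ hu))
    have e2 : (L ^ k) ((R ^ r) u) = 0 :=
      h.eq_zero_of_neg (n := 0 + r - k) (by omega) (h.lower_pow _ (h.raise_pow _ hu))
    simp only [w, Module.End.mul_apply, e1, e2, map_zero, sub_zero]
  have hanti : ∀ r k, r ≤ N → k ≤ N → w (N - k) (N - r) = - w r k := by
    intro r k hr hk
    simp only [w, Nat.sub_sub_self hr, Nat.sub_sub_self hk, neg_sub]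
  have hdiag : ∀ k ≤ N, w (N - k) k = 0 := by
    intro k hk
    simp only [w, Nat.sub_sub_self hk, sub_self]
  have hcol : ∀ k, 2 * k ≤ N → ∀ r ≤ N, w r k = 0 := by
    intro k
    induction k using Nat.strong_induction_on with
    | _ k ih =>
      intro hk
      let φ₁ : Module.End K V →ₗ[K] K := φ ∘ₗ LinearMap.applyₗ ((R ^ (N - k)) u)
      let φ₂ : Module.End K V →ₗ[K] K := φ ∘ₗ (L ^ (N - k)) ∘ₗ LinearMap.applyₗ u
      obtain ⟨c₁, hc₁⟩ := exists_coeff_of_serre hQ hQ0 h.serre_lower φ₁ k N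
      obtain ⟨c₂, hc₂⟩ := exists_coeff_of_serre_reflect hQ hQ0 h.serre_raise φ₂ k N
      have hrep : ∀ r ≤ N, w r k
          = ∑ l ∈ Finset.range (2 * k + 1), (c₁ l - c₂ l) * (Q⁻¹ ^ k * Q ^ l) ^ r := by
        intro r hr
        simp only [sub_mul, Finset.sum_sub_distrib]
        rw [← hc₁ r hr, ← hc₂ r hr]
        simp [w, φ₁, φ₂, Module.End.mul_apply]
      intro r hr
      rw [hrep r hr]
      -- The `2 * k + 1` zeros of column `k`: degree reasons for `r < k`, symmetry at `r = N - k`,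
      -- and, for `r > N - k`, the antisymmetry that carries the entry to the earlier column `N -
      -- r`.
      refine sum_geometric_eq_zero hQ hQ0 (pow_ne_zero _ (inv_ne_zero hQ0))
        (T := Finset.range k ∪ Finset.Icc (N - k) N) ?_ ?_ r
      · rw [Finset.card_union_of_disjoint, Finset.card_range, Nat.card_Icc]
        · omega
        · rw [Finset.disjoint_left]
          intro t ht ht'
          rw [Finset.mem_range] at ht
          rw [Finset.mem_Icc] at ht'
          omega
      · intro t ht
        rw [Finset.mem_union, Finset.mem_range, Finset.mem_Icc] at ht
        rw [← hrep t (by omega)]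
        rcases ht with ht | ht
        · exact hw0 t k ht (by omega)
        · rcases Nat.eq_or_lt_of_le ht.1 with ht' | ht'
          · rw [← ht']
            exact hdiag k (by omega)
          · have h3 := hanti t k ht.2 (by omega)
            have h4 := ih (N - t) (by omega) (by omega) (N - k) (by omega)
            rw [h4] at h3
            exact neg_eq_zero.1 h3.symm
  have := hcol i (by omega) i (by omega)
  have e1 : N - i = j := by omega
  simp only [w, e1] at this
  rw [map_sub]
  exact this

theorem exists_common_eigenvector [IsAlgClosed K] [FiniteDimensional K V]
    (h : IsSerreGraded Q L R d G) (hQ : ∀ n : ℕ, 0 < n → Q ^ n ≠ 1)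
    (hQ0 : Q ≠ 0) (hG : G 0 ≠ ⊥) :
    ∃ v ∈ G 0, v ≠ 0 ∧ ∀ c : ℕ, ∃ a : K, (L ^ c * R ^ c) v = a • v := by
  have hmaps : ∀ c : ℕ, ∀ u ∈ G 0, (L ^ c * R ^ c) u ∈ G 0 := by
    intro c u hu
    simpa using h.lower_pow c (h.raise_pow c hu)
  have hcomm : ∀ c b : ℕ, ∀ u ∈ G 0,
      (L ^ c * R ^ c) ((L ^ b * R ^ b) u) = (L ^ b * R ^ b) ((L ^ c * R ^ c) u) := by
    intro c b u hu
    simp only [← Module.End.mul_apply, ← mul_assoc]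
    rcases lt_trichotomy c b with hcb | rfl | hcb
    · exact h.lower_raise_comm hQ hQ0 hu hcb
    · rfl
    · exact (h.lower_raise_comm hQ hQ0 hu hcb).symm
  -- Eigenspaces are intersected one map at a time; commutativity keeps `E` stable under all the
  -- maps. Those with `c > d` vanish on `G 0`, so finitely many steps suffice.
  have key : ∀ m : ℕ, ∃ E : Submodule K V, E ≤ G 0 ∧ E ≠ ⊥ ∧
      (∀ c, ∀ u ∈ E, (L ^ c * R ^ c) u ∈ E) ∧
      ∀ c < m, ∃ a : K, ∀ u ∈ E, (L ^ c * R ^ c) u = a • u := by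
    intro m
    induction m with
    | zero => exact ⟨G 0, le_rfl, hG, hmaps, by simp⟩
    | succ m ih =>
      obtain ⟨E, hE, hE0, hEm, hEa⟩ := ih
      have : Nontrivial E := Submodule.nontrivial_iff_ne_bot.2 hE0
      obtain ⟨a, ha⟩ := Module.End.exists_eigenvalue ((L ^ m * R ^ m).restrict (hEm m))
      obtain ⟨x, hx⟩ := ha.exists_hasEigenvector
      refine ⟨E ⊓ Module.End.eigenspace (L ^ m * R ^ m) a, inf_le_left.trans hE, ?_, ?_, ?_⟩
      · refine (Submodule.ne_bot_iff _).2 ⟨x, ⟨x.2, ?_⟩, ?_⟩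
        · rw [SetLike.mem_coe, Module.End.mem_eigenspace_iff]
          exact congrArg Subtype.val hx.apply_eq_smul
        · simpa using hx.2
      · rintro c u ⟨hu, hu'⟩
        rw [SetLike.mem_coe, Module.End.mem_eigenspace_iff] at hu'
        refine ⟨hEm c u hu, ?_⟩
        rw [SetLike.mem_coe, Module.End.mem_eigenspace_iff, hcomm m c u (hE hu), hu', map_smul]
      · intro c hc
        rcases Nat.lt_succ_iff_lt_or_eq.1 hc with hc | rfl
        · obtain ⟨b, hb⟩ := hEa c hc
          exact ⟨b, fun u hu => hb u hu.1⟩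
        · exact ⟨a, fun u hu => Module.End.mem_eigenspace_iff.1 hu.2⟩
  obtain ⟨E, hE, hE0, -, hEa⟩ := key (d + 1)
  obtain ⟨v, hv, hv0⟩ := (Submodule.ne_bot_iff _).1 hE0
  refine ⟨v, hE hv, hv0, fun c => ?_⟩
  rcases Nat.lt_or_ge c (d + 1) with hc | hc
  · obtain ⟨a, ha⟩ := hEa c hc
    exact ⟨a, ha v hv⟩
  · refine ⟨0, ?_⟩
    rw [Module.End.mul_apply,
      h.eq_zero_of_lt (n := 0 + c) (by omega) (h.raise_pow c (hE hv)), map_zero, zero_smul]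

end IsSerreGraded

/-! ### Rewriting of words and its termination -/

/-- A list of naturals is strictly increasing, or ends with a non-ascent, or contains a non-ascent
followed by an ascent. -/
theorem isChain_or_exists_valley (l : List ℕ) :
    l.IsChain (· < ·) ∨ (∃ p b c, l = p ++ [b, c] ∧ c ≤ b) ∨
      ∃ p i j k t, l = p ++ i :: j :: k :: t ∧ j ≤ i ∧ j < k := by
  induction l with
  | nil => left; simp
  | cons a l ih =>
    rcases ih with ih | ⟨p, b, c, rfl, hbc⟩ | ⟨p, i, j, k, t, rfl, hij, hjk⟩
    · rcases l with _ | ⟨b, l⟩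
      · left; simp
      · rcases Nat.lt_or_ge a b with hab | hab
        · left; exact List.IsChain.cons_cons hab ih
        · rcases l with _ | ⟨c, l⟩
          · exact Or.inr (Or.inl ⟨[], a, b, rfl, hab⟩)
          · rw [List.isChain_cons_cons] at ih
            exact Or.inr (Or.inr ⟨[], a, b, c, l, rfl, hab, ih.1⟩)
    · exact Or.inr (Or.inl ⟨a :: p, b, c, rfl, hbc⟩)
    · exact Or.inr (Or.inr ⟨a :: p, i, j, k, t, rfl, hij, hjk⟩)

/-- The sum of the entries of a list, weighted by position. -/
def weightedSum : List ℕ → ℕ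
  | [] => 0
  | _ :: l => l.sum + weightedSum l

/-- The sum of the squares of the entries of a list. -/
def squareSum (l : List ℕ) : ℕ := (l.map (· ^ 2)).sum

theorem squareSum_le (l : List ℕ) : squareSum l ≤ l.sum ^ 2 := by
  induction l with
  | nil => simp [squareSum]
  | cons a l ih =>
    simp only [squareSum, List.map_cons, List.sum_cons] at *
    nlinarith [Nat.zero_le (a * l.sum)]

theorem weightedSum_append (p l : List ℕ) :
    weightedSum (p ++ l) = weightedSum p + p.length * l.sum + weightedSum l := by
  induction p with
  | nil => simp [weightedSum]
  | cons a p ih =>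
    simp only [List.cons_append, weightedSum, ih, List.sum_append, List.length_cons]
    ring

theorem altWord_append (p : List ℕ) : ∀ (X Y : Module.End K V) (l : List ℕ),
    altWord X Y (p ++ l)
      = altWord X Y p * if Even p.length then altWord X Y l else altWord Y X l := by
  induction p with
  | nil => intro X Y l; simp [altWord]
  | cons a p ih =>
    intro X Y l
    rw [List.cons_append, altWord, ih, altWord, mul_assoc, List.length_cons]
    by_cases hp : Even p.length
    · simp [hp, Nat.even_add_one]
    · simp [hp, Nat.even_add_one]

/-- The lexicographic measure that the rewriting of words decreases. -/
def wordMeasure (l : List ℕ) : ℕ ×ₗ ℕ ×ₗ ℕ :=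
  toLex (l.length, toLex (l.sum ^ 2 - squareSum l, weightedSum l))

theorem wordMeasure_lt_of_length {l l' : List ℕ} (h : l'.length < l.length) :
    wordMeasure l' < wordMeasure l :=
  Prod.Lex.toLex_lt_toLex.2 (Or.inl h)

/-- The new outer exponents have the same sum but lie farther apart, which raises the sum of
squares. The exception is the swap of `j, j, k` into `k, j, j`, which only moves the larger entry
forward and is detected by `weightedSum`. -/
theorem wordMeasure_lt_of_valley (p t : List ℕ) {i j k r s : ℕ} (hij : j ≤ i) (hjk : j < k)
    (hrs : r + s = i + k) (h : r < j ∨ s ≤ j) :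
    wordMeasure (p ++ r :: j :: s :: t) < wordMeasure (p ++ i :: j :: k :: t) := by
  have hsum : (p ++ r :: j :: s :: t).sum = (p ++ i :: j :: k :: t).sum := by
    simp only [List.sum_append, List.sum_cons]
    omega
  have hle := squareSum_le (p ++ r :: j :: s :: t)
  have hle' := squareSum_le (p ++ i :: j :: k :: t)
  refine Prod.Lex.toLex_lt_toLex.2 (Or.inr ⟨by simp, Prod.Lex.toLex_lt_toLex.2 ?_⟩)
  by_cases hswap : s = i
  · have hr : r = k := by omega
    have hs : s = j := by omega
    subst hr hs hswap
    refine Or.inr ⟨?_, ?_⟩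
    · dsimp only
      rw [hsum]
      congr 1
      simp only [squareSum, List.map_append, List.map_cons, List.sum_append, List.sum_cons]
      omega
    · dsimp only
      simp only [weightedSum_append, weightedSum, List.sum_cons]
      rw [show r + (s + (s + t.sum)) = s + (s + (r + t.sum)) by ring]
      omega
  · left
    have hsq : squareSum (p ++ i :: j :: k :: t) < squareSum (p ++ r :: j :: s :: t) := by
      -- The difference of the two sides is `2 * (i - r) * (k - r) = 2 * (i - s) * (k - s)`.
      have : i ^ 2 + k ^ 2 < r ^ 2 + s ^ 2 := by
        zify at hrs hij hjk h hswap ⊢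
        rcases h with h | h
        · nlinarith [mul_pos (show (0 : ℤ) < i - r by omega) (show (0 : ℤ) < k - r by omega)]
        · nlinarith [mul_pos (show (0 : ℤ) < i - s by omega) (show (0 : ℤ) < k - s by omega)]
      simp only [squareSum, List.map_append, List.map_cons, List.sum_append, List.sum_cons]
      omega
    rw [hsum] at *
    omega

namespace IsSerreGraded

variable {Q : K} {L R : Module.End K V} {d : ℕ} {G : ℤ → Submodule K V}

theorem altWord_mem_span (h : IsSerreGraded Q L R d G) (hQ : ∀ n : ℕ, 0 < n → Q ^ n ≠ 1)
    (hQ0 : Q ≠ 0) {v : V} (hv : v ∈ G 0)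
    (hev : ∀ c : ℕ, ∃ a : K, (L ^ c * R ^ c) v = a • v) (l : List ℕ) (hl : Even l.length) :
    altWord L R l v ∈ Submodule.span K (wordVectors L R d v) := by
  induction l using (InvImage.wf wordMeasure wellFounded_lt).induction with
  | _ l ih =>
  rcases isChain_or_exists_valley l with hc | ⟨p, b, c, rfl, hbc⟩ | ⟨p, i, j, k, t, rfl, hij, hjk⟩
  · by_cases hd : ∀ i ∈ l, i ≤ d
    · exact Submodule.subset_span ⟨l, hl, List.isChain_iff_pairwise.1 hc, hd, rfl⟩
    · push Not at hd
      obtain ⟨i, hi, hid⟩ := hd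
      rcases List.eq_nil_or_concat l with rfl | ⟨p, c, rfl⟩
      · simp at hi
      -- The last exponent is the largest, and by even length it belongs to `R`, so that power of
      -- `R` kills `v`.
      · have hic : i ≤ c := by
          have hp := List.isChain_iff_pairwise.1 hc
          rw [List.concat_eq_append, List.pairwise_append] at hp
          rw [List.concat_eq_append, List.mem_append, List.mem_singleton] at hi
          rcases hi with hi | rfl
          · exact (hp.2.2 i hi c (by simp)).le
          · exact le_rfl
        have hpo : ¬ Even p.length := by
          simpa [Nat.even_add_one] using hl
        rw [List.concat_eq_append, altWord_append, if_neg hpo]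
        simp only [altWord, mul_one, Module.End.mul_apply]
        rw [h.eq_zero_of_lt (n := 0 + c) (by omega) (h.raise_pow c hv), map_zero]
        exact zero_mem _
  · have hp : Even p.length := by
      simpa [Nat.even_add] using hl
    rw [altWord_append, if_pos hp]
    simp only [altWord, mul_one, Module.End.mul_apply]
    rcases Nat.lt_or_ge c b with hcb | hcb
    · rw [h.eq_zero_of_neg (n := 0 + c - b) (by omega) (h.lower_pow b (h.raise_pow c hv)), map_zero]
      exact zero_mem _
    · obtain rfl : b = c := le_antisymm hcb hbc
      obtain ⟨a, ha⟩ := hev b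
      rw [Module.End.mul_apply] at ha
      rw [ha, map_smul]
      exact Submodule.smul_mem _ _ (ih p (wordMeasure_lt_of_length (by simp)) hp)
  -- The parity of `p.length` decides whether the valley reads `L R L` or `R L R`; both Serre
  -- relations are needed.
  · have main : ∀ X Y : Module.End K V, serre Q X Y = 0 →
        (∀ m : List ℕ, altWord L R (p ++ m) = altWord L R p * altWord X Y m) →
        altWord L R (p ++ i :: j :: k :: t) v ∈ Submodule.span K (wordVectors L R d v) := by
      intro X Y hXY hp
      let Ψ : Module.End K V →ₗ[K] V :=
        altWord L R p ∘ₗ LinearMap.applyₗ (altWord Y X t v)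
      have hΨ : ∀ r s : ℕ, altWord L R (p ++ r :: j :: s :: t) v = Ψ (X ^ r * Y ^ j * X ^ s) := by
        intro r s
        rw [hp]
        simp [Ψ, altWord, Module.End.mul_apply]
      rw [hΨ]
      have hmem := Submodule.mem_map_of_mem (f := Ψ) (mem_span_of_serre hQ hQ0 hXY hij hjk)
      rw [Submodule.map_span] at hmem
      refine Submodule.span_le.2 ?_ hmem
      rintro _ ⟨_, ⟨r, s, hrs, hcase, rfl⟩, rfl⟩
      rw [SetLike.mem_coe, ← hΨ]
      exact ih _ (wordMeasure_lt_of_valley p t hij hjk hrs hcase) (by simpa using hl)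
    by_cases hp : Even p.length
    · exact main L R h.serre_lower fun m => by rw [altWord_append, if_pos hp]
    · exact main R L h.serre_raise fun m => by rw [altWord_append, if_neg hp]

/-- Each pair `L ^ i R ^ j` with `i < j` raises the degree by `j - i > 0`. This is what forces `G 0`
to be a line. -/
theorem wordVectors_homogeneous (h : IsSerreGraded Q L R d G) {v : V} (hv : v ∈ G 0) {w : V}
    (hw : w ∈ wordVectors L R d v) : w = v ∨ ∃ n > 0, w ∈ G n := by
  obtain ⟨l, hl, hp, -, rfl⟩ := hw
  rcases eq_or_ne l [] with rfl | hl0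
  · left; simp [altWord]
  right
  have key : ∀ n : ℕ, ∀ l : List ℕ, l.length = 2 * n → l.Pairwise (· < ·) →
      ∃ m : ℤ, 0 ≤ m ∧ (l ≠ [] → 0 < m) ∧ altWord L R l v ∈ G m := by
    intro n
    induction n with
    | zero =>
      intro l hl _
      obtain rfl : l = [] := List.length_eq_zero_iff.1 (by omega)
      exact ⟨0, le_rfl, by simp, by simpa [altWord] using hv⟩
    | succ n ih =>
      intro l hl hp
      match l, hl, hp with
      | i :: j :: t, hl, hp =>
        simp only [List.pairwise_cons, List.mem_cons, forall_eq_or_imp] at hp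
        obtain ⟨m, hm, -, hmem⟩ := ih t (by simp at hl; omega) hp.2.2
        refine ⟨m + j - i, ?_, fun _ => ?_, ?_⟩
        · have := hp.1.1
          omega
        · have := hp.1.1
          omega
        · simp only [altWord, Module.End.mul_apply]
          exact h.lower_pow _ (h.raise_pow _ hmem)
  obtain ⟨n, hn⟩ := hl
  obtain ⟨m, -, hm, hmem⟩ := key n l (by omega) hp
  exact ⟨m, hm hl0, hmem⟩

end IsSerreGraded

/-! ### From the tridiagonal pair to the graded Serre relations -/

/-- If `A = R + a Q ^ n` and `B = L + b Q ^ (-n)` on the degree `n` piece, where `R` raises and `L`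
lowers the degree, then the `q`-Serre relation of `A, B` passes to `R, L`. -/
theorem serre_eq_zero_of_graded {Q : K} (hQ0 : Q ≠ 0) {A B R L : Module.End K V}
    {G : ℤ → Submodule K V} (hind : iSupIndep G) (htop : ⨆ n, G n = ⊤) {a b : K}
    (hR : ∀ n, ∀ u ∈ G n, R u ∈ G (n + 1)) (hL : ∀ n, ∀ u ∈ G n, L u ∈ G (n - 1))
    (hA : ∀ n, ∀ u ∈ G n, A u = R u + (a * Q ^ n) • u)
    (hB : ∀ n, ∀ u ∈ G n, B u = L u + (b * Q ^ (-n)) • u)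
    (h : serre Q A B = 0) : serre Q R L = 0 := by
  have key : ∀ n, ∀ u ∈ G n, serre Q R L u = 0 := by
    intro n u hu
    -- Working modulo `W` extracts the component of degree `n + 2`, where only `serre Q R L u` and a
    -- multiple of `R (R u)` survive.
    let W : Submodule K V := ⨆ j, ⨆ (_ : j ≠ n + 2), G j
    have hW : ∀ j, j ≠ n + 2 → ∀ x ∈ G j, W.mkQ x = 0 := fun j hj x hx => by
      rw [Submodule.mkQ_apply, Submodule.Quotient.mk_eq_zero]
      exact Submodule.mem_iSup_of_mem j (Submodule.mem_iSup_of_mem hj hx)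
    have m1 : R u ∈ G (n + 1) := hR _ _ hu
    have m2 : R (R u) ∈ G (n + 2) := by simpa [add_assoc] using hR _ _ m1
    have m3 : R (R (R u)) ∈ G (n + 3) := by simpa [add_assoc] using hR _ _ m2
    have l0 : L u ∈ G (n - 1) := hL _ _ hu
    have l1 : R (L u) ∈ G n := by simpa using hR _ _ l0
    have l2 : R (R (L u)) ∈ G (n + 1) := hR _ _ l1
    have l3 : R (R (R (L u))) ∈ G (n + 2) := by simpa [add_assoc] using hR _ _ l2
    have p1 : L (R u) ∈ G n := by simpa using hL _ _ m1
    have p2 : R (L (R u)) ∈ G (n + 1) := hR _ _ p1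
    have p3 : R (R (L (R u))) ∈ G (n + 2) := by simpa [add_assoc] using hR _ _ p2
    have s2 : L (R (R u)) ∈ G (n + 1) := by
      have := hL _ _ m2
      rwa [show n + 2 - 1 = n + 1 by ring] at this
    have s3 : R (L (R (R u))) ∈ G (n + 2) := by simpa [add_assoc] using hR _ _ s2
    have t3 : L (R (R (R u))) ∈ G (n + 2) := by
      have := hL _ _ m3
      rwa [show n + 3 - 1 = n + 2 by ring] at this
    have hmem : serre Q R L u ∈ G (n + 2) := by
      simp only [serre, LinearMap.sub_apply, LinearMap.add_apply, LinearMap.smul_apply, pow_succ,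
        pow_zero, one_mul, Module.End.mul_apply]
      exact sub_mem (add_mem (sub_mem l3 (Submodule.smul_mem _ _ p3)) (Submodule.smul_mem _ _ s3))
        t3
    have h0 : W.mkQ (serre Q A B u) = 0 := by rw [h]; simp
    have hz : (W.mkQ) (serre Q R L u) = 0 := by
      simp only [serre, LinearMap.sub_apply, LinearMap.add_apply, LinearMap.smul_apply, pow_succ,
        pow_zero, one_mul, Module.End.mul_apply] at h0 ⊢
      simp only [hA _ _ hu, hA _ _ m1, hA _ _ m2, hA _ _ l0, hA _ _ l1, hA _ _ l2,
        hA _ _ p1, hA _ _ p2, hA _ _ s2, hB _ _ hu, hB _ _ m1, hB _ _ m2, hB _ _ m3,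
        map_add, map_smul, map_sub, smul_add, hW _ (by omega) _ hu, hW _ (by omega) _ m1,
        hW _ (by omega) _ m3, hW _ (by omega) _ l0, hW _ (by omega) _ l1, hW _ (by omega) _ l2,
        hW _ (by omega) _ p1, hW _ (by omega) _ p2, hW _ (by omega) _ s2, smul_zero, add_zero,
        zero_add] at h0 ⊢
      have e1 : Q ^ (n + 1) = Q ^ n * Q := zpow_add_one₀ hQ0 n
      have e2 : Q ^ (n + 2) = Q ^ n * Q * Q := by
        rw [← e1, ← zpow_add_one₀ hQ0]; congr 1; ring
      have f1 : Q ^ (-(n + 1)) = Q ^ (-n) * Q⁻¹ := by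
        rw [← zpow_sub_one₀ hQ0]; congr 1; ring
      have f2 : Q ^ (-(n + 2)) = Q ^ (-n) * Q⁻¹ * Q⁻¹ := by
        rw [← f1, ← zpow_sub_one₀ hQ0]; congr 1; ring
      rw [e1, e2, f1, f2] at h0
      have hinv : Q * Q⁻¹ = 1 := mul_inv_cancel₀ hQ0
      generalize Q⁻¹ = P at *
      generalize Q ^ n = z at *
      generalize Q ^ (-n) = w at *
      -- This is the coefficient of `R (R u)`; it vanishes for eigenvalues in geometric progression
      -- of ratios `Q` and `Q⁻¹`.
      have hk : b * w * (a * z + a * (z * Q) + a * (z * Q * Q))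
          - (Q + 1 + P) * (a * z * (b * w)
            + b * (w * P) * (a * (z * Q) + a * (z * Q * Q)))
          + (Q + 1 + P) * (b * (w * P * P) * (a * (z * Q * Q))
            + (a * z + a * (z * Q)) * (b * (w * P)))
          - b * (w * P * P) * (a * z + a * (z * Q) + a * (z * Q * Q)) = 0 := by
        linear_combination b * w * a * z * (-(Q + 1 + P) * (1 + Q) + (Q + 1 + P) * (1 + Q * P)
          + (Q + 1 + P) - P - (1 + Q * P)) * hinv
      linear_combination (norm := module) h0 - hk • W.mkQ (R (R u))
    rw [Submodule.mkQ_apply, Submodule.Quotient.mk_eq_zero] at hz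
    exact Submodule.disjoint_def.1 (hind (n + 2)) _ hmem hz
  rw [← LinearMap.ker_eq_top, eq_top_iff, ← htop]
  exact iSup_le fun n u hu => key n u hu

/-- The decomposition `U 0, …, U d` indexed by the integers, with zero pieces outside `0, …, d`. -/
def gradedPart {d : ℕ} (U : Fin (d + 1) → Submodule K V) (n : ℤ) : Submodule K V :=
  ⨆ (i : Fin (d + 1)) (_ : ((i : ℕ) : ℤ) = n), U i

section gradedPart

variable {d : ℕ} (U : Fin (d + 1) → Submodule K V)

theorem gradedPart_coe (i : Fin (d + 1)) : gradedPart U ((i : ℕ) : ℤ) = U i := by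
  refine le_antisymm (iSup₂_le fun j hj => ?_) (le_iSup₂_of_le i rfl le_rfl)
  obtain rfl : j = i := Fin.ext (by exact_mod_cast hj)
  exact le_rfl

theorem gradedPart_cases (n : ℤ) :
    (∃ i : Fin (d + 1), ((i : ℕ) : ℤ) = n) ∨ ((n < 0 ∨ d < n) ∧ gradedPart U n = ⊥) := by
  by_cases h : ∃ i : Fin (d + 1), ((i : ℕ) : ℤ) = n
  · exact Or.inl h
  · refine Or.inr ⟨?_, ?_⟩
    · by_contra! hn
      exact h ⟨⟨n.toNat, by omega⟩, by simp only; omega⟩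
    · rw [gradedPart, eq_bot_iff]
      exact iSup₂_le fun i hi => absurd ⟨i, hi⟩ h

theorem gradedPart_eq_bot_of_neg {n : ℤ} (hn : n < 0) : gradedPart U n = ⊥ := by
  rcases gradedPart_cases U n with ⟨i, rfl⟩ | h
  · omega
  · exact h.2

theorem gradedPart_eq_bot_of_lt {n : ℤ} (hn : d < n) : gradedPart U n = ⊥ := by
  rcases gradedPart_cases U n with ⟨i, rfl⟩ | h
  · omega
  · exact h.2

theorem iSup_gradedPart : ⨆ n, gradedPart U n = ⨆ i, U i := by
  refine le_antisymm (iSup_le fun n => iSup₂_le fun i _ => le_iSup U i) (iSup_le fun i => ?_)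
  rw [← gradedPart_coe U i]
  exact le_iSup (gradedPart U) _

theorem iSupIndep_gradedPart (h : iSupIndep U) : iSupIndep (gradedPart U) := by
  intro n
  rcases gradedPart_cases U n with ⟨i, rfl⟩ | ⟨-, h0⟩
  · rw [gradedPart_coe]
    refine (h i).mono_right (iSup₂_le fun n hn => iSup₂_le fun j hj => ?_)
    refine le_iSup₂_of_le j ?_ le_rfl
    rintro rfl
    exact hn hj.symm
  · rw [h0]
    exact disjoint_bot_left

end gradedPart

/-- The eigenvalue `θ₀` of a map that is triangular with distinct diagonal entries on a graded
space has an eigenvector in degree `0`. -/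
theorem mem_graded_zero_of_eigenvector {B L : Module.End K V} {d : ℕ} {G : ℤ → Submodule K V}
    (htop : ⨆ n, G n = ⊤) (hneg : ∀ n < 0, G n = ⊥) (hlt : ∀ n : ℤ, d < n → G n = ⊥) {t : ℤ → K}
    (hL : ∀ n, ∀ u ∈ G n, L u ∈ G (n - 1)) (hB : ∀ n, ∀ u ∈ G n, B u = L u + t n • u)
    (ht : ∀ m : ℕ, m < d → t 0 ≠ t (m + 1)) {x : V} (hx : B x = t 0 • x) : x ∈ G 0 := by
  let P : ℤ → Submodule K V := fun m => ⨆ (j : ℤ) (_ : j ≤ m), G j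
  have hP : ∀ {j m : ℤ}, j ≤ m → G j ≤ P m := fun {j m} h => le_iSup₂_of_le j h le_rfl
  have hstep : ∀ m : ℕ, m < d → x ∈ P (m + 1) → x ∈ P m := by
    intro m hm hxm
    -- `B - t (m + 1)` lowers the filtration by one step but acts on `x` as a nonzero scalar, so `x`
    -- itself descends.
    have hle : P (m + 1) ≤ (P m).comap (B - t (m + 1) • (1 : Module.End K V)) := by
      refine iSup₂_le fun j hj u hu => ?_
      simp only [Submodule.mem_comap, LinearMap.sub_apply, LinearMap.smul_apply,
        Module.End.one_apply]
      rw [hB j u hu, add_sub_assoc, ← sub_smul]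
      refine add_mem (hP (by omega) (hL j u hu)) ?_
      rcases hj.eq_or_lt with rfl | hj
      · rw [sub_self, zero_smul]
        exact zero_mem _
      · exact Submodule.smul_mem _ _ (hP (by omega) hu)
    have := hle hxm
    simp only [Submodule.mem_comap, LinearMap.sub_apply, LinearMap.smul_apply,
      Module.End.one_apply, hx, ← sub_smul] at this
    exact (Submodule.smul_mem_iff _ (sub_ne_zero.2 (ht m hm))).1 this
  have hall : ∀ m : ℕ, m ≤ d → x ∈ P m → x ∈ P 0 := by
    intro m
    induction m with
    | zero => intro _ h; simpa using h
    | succ m ih =>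
      intro hm h
      exact ih (by omega) (hstep m (by omega) (by simpa using h))
  have hd : x ∈ P d := by
    have : (⊤ : Submodule K V) ≤ P d := by
      rw [← htop]
      refine iSup_le fun n => ?_
      rcases le_or_gt n d with hn | hn
      · exact hP hn
      · rw [hlt n hn]; exact bot_le
    exact this trivial
  have h0 : P 0 ≤ G 0 := by
    refine iSup₂_le fun j hj => ?_
    rcases hj.eq_or_lt with rfl | hj
    · exact le_rfl
    · rw [hneg j hj]; exact bot_le
  exact h0 (hall d le_rfl hd)

theorem sum_smul_proj_apply {d : ℕ} {U : Fin (d + 1) → Submodule K V}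
    (hU : DirectSum.IsInternal U) (θ : Fin (d + 1) → K) {i : Fin (d + 1)} {u : V} (hu : u ∈ U i) :
    (∑ h, θ h • proj hU h) u = θ i • u := by
  rw [LinearMap.sum_apply, Finset.sum_eq_single i]
  · rw [LinearMap.smul_apply, proj_of_mem hU i hu]
  · intro j _ hj
    rw [LinearMap.smul_apply, proj_of_mem_ne hU hj.symm hu, smul_zero]
  · simp

section SplitDecomposition

variable {A Astar : Module.End K V} {d : ℕ} {θ θstar : Fin (d + 1) → K}
  {U : Fin (d + 1) → Submodule K V} (hU : IsSplitDecomposition A Astar θ θstar U)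

theorem IsSplitDecomposition.raisingMap_mem (n : ℤ) (u : V) (hu : u ∈ gradedPart U n) :
    raisingMap hU u ∈ gradedPart U (n + 1) := by
  rcases gradedPart_cases U n with ⟨i, rfl⟩ | ⟨-, h0⟩
  · rw [gradedPart_coe] at hu
    rw [raisingMap, LinearMap.sub_apply, sum_smul_proj_apply hU.isInternal θ hu]
    induction i using Fin.lastCases with
    | last => rw [hU.raise_last u hu]; exact zero_mem _
    | cast i =>
      have := hU.raise i u hu
      rw [← gradedPart_coe U] at this
      simpa using this
  · rw [h0, Submodule.mem_bot] at hu
    rw [hu, map_zero]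
    exact zero_mem _

theorem IsSplitDecomposition.loweringMap_mem (n : ℤ) (u : V) (hu : u ∈ gradedPart U n) :
    loweringMap hU u ∈ gradedPart U (n - 1) := by
  rcases gradedPart_cases U n with ⟨i, rfl⟩ | ⟨-, h0⟩
  · rw [gradedPart_coe] at hu
    rw [loweringMap, LinearMap.sub_apply, sum_smul_proj_apply hU.isInternal θstar hu]
    induction i using Fin.cases with
    | zero => rw [hU.lower_zero u hu]; exact zero_mem _
    | succ i =>
      have := hU.lower i u hu
      rw [← gradedPart_coe U] at this
      simpa using this
  · rw [h0, Submodule.mem_bot] at hu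
    rw [hu, map_zero]
    exact zero_mem _

theorem IsSplitDecomposition.apply_eq_raisingMap_add {t : ℤ → K}
    (ht : ∀ i : Fin (d + 1), θ i = t (i : ℕ)) (n : ℤ) (u : V) (hu : u ∈ gradedPart U n) :
    A u = raisingMap hU u + t n • u := by
  rcases gradedPart_cases U n with ⟨i, rfl⟩ | ⟨-, h0⟩
  · rw [gradedPart_coe] at hu
    rw [raisingMap, LinearMap.sub_apply, sum_smul_proj_apply hU.isInternal θ hu, ht]
    simp
  · rw [h0, Submodule.mem_bot] at hu
    simp [hu]

theorem IsSplitDecomposition.star_apply_eq_loweringMap_add {t : ℤ → K}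
    (ht : ∀ i : Fin (d + 1), θstar i = t (i : ℕ)) (n : ℤ) (u : V) (hu : u ∈ gradedPart U n) :
    Astar u = loweringMap hU u + t n • u := by
  rcases gradedPart_cases U n with ⟨i, rfl⟩ | ⟨-, h0⟩
  · rw [gradedPart_coe] at hu
    rw [loweringMap, LinearMap.sub_apply, sum_smul_proj_apply hU.isInternal θstar hu, ht]
    simp
  · rw [h0, Submodule.mem_bot] at hu
    simp [hu]

end SplitDecomposition

theorem serre_eq_commutator {S : Type*} [Ring S] [Algebra K S] {Q : K} (x y : S) :
    serre Q x y = ⁅x, x ^ 2 * y - (Q + Q⁻¹) • (x * y * x) + y * x ^ 2⁆ := by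
  rw [Ring.lie_def, serre]
  simp only [mul_sub, sub_mul, mul_add, add_mul, smul_mul_assoc, mul_smul_comm, mul_assoc,
    pow_succ, pow_zero, one_mul, add_smul, one_smul]
  abel

end TDPair

/-- Over an algebraically closed field of characteristic zero, with `q` nonzero and not a root of
unity, `V` is spanned by the vectors `L ^ i₁ R ^ i₂ ⋯ R ^ iₙ v` for every nonzero `v ∈ U 0`, and
such a `v` exists. -/
theorem theorem1p7 {K V : Type*} [Field K] [IsAlgClosed K] [CharZero K]
    [AddCommGroup V] [Module K V] [FiniteDimensional K V] [Nontrivial V]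
    (q : K) (hq0 : q ≠ 0) (hq : ∀ n : ℕ, 0 < n → q ^ n ≠ 1)
    (A Astar : Module.End K V) (hA : TDPair.IsTridiagonalPair A Astar)
    (hrel : TDPair.TridiagonalRelations A Astar (q ^ (2 : ℤ) + q ^ (-2 : ℤ)) 0 0 0 0)
    (d : ℕ) (θ θstar : Fin (d + 1) → K)
    (hθ : TDPair.IsStandardOrdering A Astar θ)
    (hθstar : TDPair.IsStandardOrdering Astar A θstar)
    (a astar : K)
    (hθ_eq : ∀ i : Fin (d + 1), θ i = a * q ^ (2 * (i : ℤ) - (d : ℤ)))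
    (hθstar_eq : ∀ i : Fin (d + 1), θstar i = astar * q ^ ((d : ℤ) - 2 * (i : ℤ)))
    (U : Fin (d + 1) → Submodule K V)
    (hU : TDPair.IsSplitDecomposition A Astar θ θstar U) :
    (∃ v ∈ U 0, v ≠ 0) ∧
      ∀ v ∈ U 0, v ≠ 0 →
        Submodule.span K
          (TDPair.wordVectors (TDPair.loweringMap hU) (TDPair.raisingMap hU) d v) = ⊤ := by
  open TDPair in
  set L := loweringMap hU
  set R := raisingMap hU
  let Q : K := q ^ 2
  have hQ0 : Q ≠ 0 := pow_ne_zero _ hq0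
  have hQ : ∀ n : ℕ, 0 < n → Q ^ n ≠ 1 := fun n hn => by
    rw [← pow_mul]
    exact hq _ (by omega)
  let G := gradedPart U
  have hind : iSupIndep G := iSupIndep_gradedPart U hU.isInternal.submodule_iSupIndep
  have htop : ⨆ n, G n = ⊤ := by
    rw [iSup_gradedPart, hU.isInternal.submodule_iSup_eq_top]
  have hzpow : ∀ n : ℤ, Q ^ n = q ^ (2 * n) := fun n => by
    simp only [Q, zpow_mul, zpow_ofNat]
  have hAu : ∀ n, ∀ u ∈ G n, A u = R u + (a * q ^ (-(d : ℤ)) * Q ^ n) • u :=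
    hU.apply_eq_raisingMap_add fun i => by
      rw [hθ_eq, hzpow, mul_assoc, ← zpow_add₀ hq0]
      congr 2
      ring
  have hBu : ∀ n, ∀ u ∈ G n, Astar u = L u + (astar * q ^ (d : ℤ) * Q ^ (-n)) • u :=
    hU.star_apply_eq_loweringMap_add fun i => by
      rw [hθstar_eq, hzpow, mul_assoc, ← zpow_add₀ hq0]
      congr 2
      ring
  have hβ : q ^ (2 : ℤ) + q ^ (-2 : ℤ) = Q + Q⁻¹ := by
    simp only [Q, zpow_neg]
    norm_cast
  have hAB : serre Q A Astar = 0 := by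
    rw [serre_eq_commutator, ← hβ]
    simpa using hrel.rel
  have hBA : serre Q Astar A = 0 := by
    rw [serre_eq_commutator, ← hβ]
    simpa using hrel.rel_star
  have hLR : serre Q L R = 0 := by
    -- Reversing the grading exchanges the roles of raising and lowering, and of `Q ^ n` and `Q ^
    -- (-n)`.
    refine serre_eq_zero_of_graded (G := fun n => G (-n)) (a := astar * q ^ (d : ℤ)) hQ0
      (hind.comp neg_injective) ?_ (fun n u hu => ?_) (fun n u hu => ?_) (fun n u hu => ?_)
      (fun n u hu => hAu (-n) u hu) hBA
    · rw [← htop]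
      exact (Equiv.neg ℤ).iSup_comp (g := G)
    · have := hU.loweringMap_mem _ u hu
      rwa [show -n - 1 = -(n + 1) by ring] at this
    · have := hU.raisingMap_mem _ u hu
      rwa [show -n + 1 = -(n - 1) by ring] at this
    · have := hBu (-n) u hu
      rwa [neg_neg] at this
  have hG : IsSerreGraded Q L R d G :=
    { raise := hU.raisingMap_mem
      lower := hU.loweringMap_mem
      eq_bot_of_neg := fun n hn => gradedPart_eq_bot_of_neg U hn
      eq_bot_of_lt := fun n hn => gradedPart_eq_bot_of_lt U hn
      serre_raise := serre_eq_zero_of_graded hQ0 hind htop hU.raisingMap_mem hU.loweringMap_mem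
        hAu hBu hAB
      serre_lower := hLR }
  have hG0 : G 0 = U 0 := by
    simpa using gradedPart_coe U 0
  have hne : G 0 ≠ ⊥ := by
    have hev : Astar.HasEigenvalue (θstar 0) := by
      have : θstar 0 ∈ Set.range θstar := ⟨0, rfl⟩
      rwa [hθstar.range_eq] at this
    obtain ⟨x, hx⟩ := hev.exists_hasEigenvector
    have h0 : θstar 0 = astar * q ^ (d : ℤ) * Q ^ (-(0 : ℤ)) := by
      rw [hθstar_eq]; simp
    refine (Submodule.ne_bot_iff _).2 ⟨x, mem_graded_zero_of_eigenvector htop hG.eq_bot_of_neg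
      hG.eq_bot_of_lt hG.lower hBu (fun m hm h => ?_) (by rw [← h0]; exact hx.apply_eq_smul), hx.2⟩
    have h1 : θstar ⟨m + 1, by omega⟩ = astar * q ^ (d : ℤ) * Q ^ (-((m : ℤ) + 1)) := by
      rw [hθstar_eq, hzpow, mul_assoc, ← zpow_add₀ hq0]
      congr 2
    have h2 := hθstar.injective ((h0.trans h).trans h1.symm)
    simp [Fin.ext_iff] at h2
  have hspan : ∀ v ∈ G 0, v ≠ 0 → (∀ c : ℕ, ∃ b : K, (L ^ c * R ^ c) v = b • v) →
      Submodule.span K (wordVectors L R d v) = ⊤ := by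
    intro v hv hv0 hev
    set W := Submodule.span K (wordVectors L R d v) with hW
    have hmem := hG.altWord_mem_span hQ hQ0 hv hev
    have hhom : ∀ w ∈ wordVectors L R d v, ∃ n, w ∈ G n := fun w hw => by
      rcases hG.wordVectors_homogeneous hv hw with rfl | ⟨n, -, hn⟩
      exacts [⟨0, hv⟩, ⟨n, hn⟩]
    by_contra hWtop
    refine hA.irreducible ⟨W, ?_, ?_, ?_, hWtop⟩
    · rw [hW, Submodule.map_span_le, ← hW]
      intro w hw
      obtain ⟨n, hn⟩ := hhom w hw
      rw [hAu n w hn]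
      refine add_mem ?_ (Submodule.smul_mem _ _ (Submodule.subset_span hw))
      obtain ⟨l, hl, -, -, rfl⟩ := hw
      -- The word `L ^ 0 R ^ 1 ⋯` need not be increasing, but it has even length, so rewriting puts
      -- it in the span.
      simpa [altWord] using hmem (0 :: 1 :: l) (by simpa [Nat.even_add_one] using hl)
    · rw [hW, Submodule.map_span_le, ← hW]
      intro w hw
      obtain ⟨n, hn⟩ := hhom w hw
      rw [hBu n w hn]
      refine add_mem ?_ (Submodule.smul_mem _ _ (Submodule.subset_span hw))
      obtain ⟨l, hl, -, -, rfl⟩ := hw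
      rcases l with _ | ⟨i, l⟩
      · simpa [altWord] using hmem [1, 0] (by simp)
      · simpa [altWord, pow_succ', Module.End.mul_apply] using hmem ((i + 1) :: l) (by simpa using hl)
    · exact (Submodule.ne_bot_iff _).2
        ⟨v, by simpa [altWord] using hmem [] (by simp), hv0⟩
  obtain ⟨v, hv, hv0, hev⟩ := hG.exists_common_eigenvector hQ hQ0 hne
  refine ⟨⟨v, hG0 ▸ hv, hv0⟩, fun u hu hu0 => ?_⟩
  rw [← hG0] at hu
  -- All spanning vectors other than `v` have positive degree, so the degree `0` part of `V` is the
  -- line through `v`.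
  have hline : ∃ c : K, c • v = u := by
    have hle : Submodule.span K (wordVectors L R d v)
        ≤ (K ∙ v) ⊔ ⨆ j, ⨆ (_ : j ≠ (0 : ℤ)), G j := by
      rw [Submodule.span_le]
      intro w hw
      rcases hG.wordVectors_homogeneous hv hw with rfl | ⟨n, hn, hwn⟩
      · exact Submodule.mem_sup_left (Submodule.mem_span_singleton_self _)
      · exact Submodule.mem_sup_right
          (Submodule.mem_iSup_of_mem n (Submodule.mem_iSup_of_mem hn.ne' hwn))
    rw [hspan v hv hv0 hev] at hle
    obtain ⟨y, hy, z, hz, hyz⟩ := Submodule.mem_sup.1 (hle (Submodule.mem_top (x := u)))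
    obtain ⟨c, rfl⟩ := Submodule.mem_span_singleton.1 hy
    refine ⟨c, ?_⟩
    have hz0 : z ∈ G 0 := by
      rw [← eq_sub_iff_add_eq'] at hyz
      rw [hyz]
      exact sub_mem hu (Submodule.smul_mem _ _ hv)
    rw [← hyz, Submodule.disjoint_def.1 (hind 0) z hz0 hz, add_zero]
  obtain ⟨c, rfl⟩ := hline
  refine hspan _ hu hu0 fun k => ?_
  obtain ⟨b, hb⟩ := hev k
  exact ⟨b, by rw [map_smul, hb, smul_comm]⟩
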